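/- **Setting.** For a small preadditive category $\mathcal R$, let $\mathcal R\text{-Mod}$ be the category of additive functors $\mathcal R\to\mathbf{Ab}$ (left modules) and $\text{Mod-}\mathcal R$ the category of additive functors $\mathcal R^{op}\to\mathbf{Ab}$ (right modules). Let $\mathbb{MODCAT}$ be the 2-category whose 0-cells are small preadditive categories, whose 1-cells $\mathcal R\to\mathcal S$ are the accessible additive functors $\mathcal R\text{-Mod}\to\mathcal S\text{-Mod}$ (accessible: preserving $\lambda$-directed colimits for some regular cardinal $\lambda$), and whose 2-cells are natural transformations; $\mathbb{MODCAT}^{co}$ is $\mathbb{MODCAT}$ with the 2-cells reversed. For $N\in\text{Mod-}\mathcal R$ and $M\in\mathcal R\text{-Mod}$, $N\otimes_{\mathcal R}M$ is the abelian group generated by symbols $n\otimes m$ ($r\in\mathcal R$, $n\in N(r)$, $m\in M(r)$), additive in $n$ and $m$, with $N(f)(n)\otimes m=n\otimes M(f)(m)$ for $f:r\to s$ in $\mathcal R$, $n\in N(s)$, $m\in M(r)$. Write $(\Phi,\Psi)$ for the abelian group of natural transformations $\Phi\to\Psi$, and for $F:\mathcal R\text{-Mod}\to\mathcal S\text{-Mod}$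 and $s\in\mathcal S$ write $(F-)s$ for the functor $M\mapsto (FM)(s)$. **Theorem.** 1. For every 1-cell $F:\mathcal R\to\mathcal S$ of $\mathbb{MODCAT}$, the groups $((F-)s,\,N\otimes_{\mathcal R}-)$ are small (in bijection with a set), and $$((DF)N)(s)=\bigl((F-)s,\;N\otimes_{\mathcal R}-\bigr)\qquad(N\in\text{Mod-}\mathcal R,\ s\in\mathcal S)$$ defines an accessible additive functor $DF:\text{Mod-}\mathcal R\to\text{Mod-}\mathcal S$, the Auslander–Gruson–Jensen dual of $F$; that is, $DF$ is a 1-cell $\mathcal R^{op}\to\mathcal S^{op}$. 2. Fix such a dual $DF$ for every 1-cell $F$ (it is unique up to a unique isomorphism compatible with the identifications above). Put $D\mathcal R=\mathcal R^{op}$; for a 2-cell $\alpha:F\to G$ let $D\alpha:DG\to DF$ be precomposition with $\alpha$. For 1-cells $F:\mathcal R\to\mathcal S$ and $G:\mathcal S\to\mathcal T$ let $$\delta_{G,F}:(DG)(DF)\to D(GF),\qquad \delta_{G,F}(\alpha)_M=\beta_{N,M}\circ\alpha_{FM}$$ for $N\in\text{Mod-}\mathcal R$, $t\in\mathcal T$,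 $\alpha:(G-)t\to (DF)N\otimes_{\mathcal S}-$ and $M\in\mathcal R\text{-Mod}$, where $\beta_{N,M}:(DF)N\otimes_{\mathcal S}FM\to N\otimes_{\mathcal R}M$ is given by $a\otimes z\mapsto a_M(z)$. Let $$\psi_{\mathcal R}:1_{\mathcal R^{op}}\to D(1_{\mathcal R}),\qquad (\psi_{\mathcal R}(x))_M(y)=x\otimes y\quad (x\in N(r),\ y\in M(r)).$$ Then $(D,\delta,\psi)$ is a lax 2-functor $\mathbb{MODCAT}^{co}\to\mathbb{MODCAT}$. 3. If $(L,\ \Delta:L\to L^2,\ \epsilon:L\to 1_{\mathcal R})$ is a comonad on $\mathcal R\text{-Mod}$ whose functor $L$ is additive and accessible, then $\bigl(DL,\ (D\Delta)\circ\delta_{L,L},\ (D\epsilon)\circ\psi_{\mathcal R}\bigr)$ is a monad on $\text{Mod-}\mathcal R$ whose functor $DL$ is accessible. -/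

import Mathlib

open CategoryTheory Opposite Bicategory

universe u w v

noncomputable section

namespace AGJ

/-! ### Modules over small preadditive categories -/

/-- Left modules over a small preadditive category `R`: additive functors `R ⥤ Ab`.
Right `R`-modules are left modules over `Rᵒᵖ`. -/
abbrev LMod (R : Type u) [SmallCategory R] [Preadditive R] := R ⥤+ AddCommGrpCat.{u}

/-- Right modules over a small preadditive category `R`: additive functors `Rᵒᵖ ⥤ Ab`. -/
abbrev RMod (R : Type u) [SmallCategory R] [Preadditive R] := LMod Rᵒᵖ

/-! ### The tensor product of a right module and a left module -/

section Tensor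

variable {R : Type u} [SmallCategory R]

/-- The relators of `N ⊗_R M`: additivity in both variables, and `(n · f) ⊗ m - n ⊗ (f · m)` for
`f : r ⟶ s` in `R`, `n ∈ N s`, `m ∈ M r`. -/
inductive TensorRelator (N : Rᵒᵖ ⥤ AddCommGrpCat.{u}) (M : R ⥤ AddCommGrpCat.{u}) :
    FreeAbelianGroup (Σ r : R, N.obj (op r) × M.obj r) → Prop
  | add_left (r : R) (n n' : N.obj (op r)) (m : M.obj r) :
      TensorRelator N M (FreeAbelianGroup.of ⟨r, n + n', m⟩
        - (FreeAbelianGroup.of ⟨r, n, m⟩ + FreeAbelianGroup.of ⟨r, n', m⟩))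
  | add_right (r : R) (n : N.obj (op r)) (m m' : M.obj r) :
      TensorRelator N M (FreeAbelianGroup.of ⟨r, n, m + m'⟩
        - (FreeAbelianGroup.of ⟨r, n, m⟩ + FreeAbelianGroup.of ⟨r, n, m'⟩))
  | balanced {r s : R} (f : r ⟶ s) (n : N.obj (op s)) (m : M.obj r) :
      TensorRelator N M (FreeAbelianGroup.of ⟨r, N.map f.op n, m⟩
        - FreeAbelianGroup.of ⟨s, n, M.map f m⟩)

/-- The abelian group `N ⊗_R M`. -/
def Tensor (N : Rᵒᵖ ⥤ AddCommGrpCat.{u}) (M : R ⥤ AddCommGrpCat.{u}) : Type u :=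
  FreeAbelianGroup (Σ r : R, N.obj (op r) × M.obj r) ⧸
    AddSubgroup.closure {x | TensorRelator N M x}

instance (N : Rᵒᵖ ⥤ AddCommGrpCat.{u}) (M : R ⥤ AddCommGrpCat.{u}) :
    AddCommGroup (Tensor N M) :=
  inferInstanceAs (AddCommGroup (FreeAbelianGroup (Σ r : R, N.obj (op r) × M.obj r) ⧸
    AddSubgroup.closure {x | TensorRelator N M x}))

variable {N : Rᵒᵖ ⥤ AddCommGrpCat.{u}} {M : R ⥤ AddCommGrpCat.{u}}

/-- The element `n ⊗ m` of `N ⊗_R M`. -/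
def tmul {r : R} (n : N.obj (op r)) (m : M.obj r) : Tensor N M :=
  QuotientAddGroup.mk' _ (FreeAbelianGroup.of ⟨r, n, m⟩)

lemma tensor_mk_eq {x y : FreeAbelianGroup (Σ r : R, N.obj (op r) × M.obj r)}
    (h : TensorRelator N M (x - y)) :
    (QuotientAddGroup.mk' (AddSubgroup.closure {x | TensorRelator N M x})) x =
      QuotientAddGroup.mk' (AddSubgroup.closure {x | TensorRelator N M x}) y := by
  rw [← sub_eq_zero, ← map_sub]
  exact (QuotientAddGroup.eq_zero_iff _).2 (AddSubgroup.subset_closure h)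

lemma add_tmul {r : R} (n n' : N.obj (op r)) (m : M.obj r) :
    (tmul (n + n') m : Tensor N M) = tmul n m + tmul n' m :=
  (tensor_mk_eq (.add_left r n n' m)).trans (map_add _ _ _)

lemma tmul_add {r : R} (n : N.obj (op r)) (m m' : M.obj r) :
    (tmul n (m + m') : Tensor N M) = tmul n m + tmul n m' :=
  (tensor_mk_eq (.add_right r n m m')).trans (map_add _ _ _)

lemma tmul_balanced {r s : R} (f : r ⟶ s) (n : N.obj (op s)) (m : M.obj r) :
    (tmul (N.map f.op n) m : Tensor N M) = tmul n (M.map f m) :=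
  tensor_mk_eq (.balanced f n m)

/-- The universal property of `N ⊗_R M`. -/
def tensorLift {A : Type v} [AddCommGroup A]
    (φ : ∀ r : R, N.obj (op r) → M.obj r → A)
    (add_left : ∀ r n n' m, φ r (n + n') m = φ r n m + φ r n' m)
    (add_right : ∀ r n m m', φ r n (m + m') = φ r n m + φ r n m')
    (balanced : ∀ (r s : R) (f : r ⟶ s) (n : N.obj (op s)) (m : M.obj r),
      φ r (N.map f.op n) m = φ s n (M.map f m)) : Tensor N M →+ A :=
  QuotientAddGroup.lift _ (FreeAbelianGroup.lift fun p => φ p.1 p.2.1 p.2.2) (by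
    rw [AddSubgroup.closure_le]
    rintro _ (⟨r, n, n', m⟩ | ⟨r, n, m, m'⟩ | ⟨f, n, m⟩)
    · simp [add_left]
    · simp [add_right]
    · simp [balanced])

@[simp]
lemma tensorLift_tmul {A : Type v} [AddCommGroup A]
    (φ : ∀ r : R, N.obj (op r) → M.obj r → A) (h₁ h₂ h₃)
    {r : R} (n : N.obj (op r)) (m : M.obj r) :
    tensorLift φ h₁ h₂ h₃ (tmul n m) = φ r n m := by
  exact FreeAbelianGroup.lift_apply_of _ _

lemma tensor_hom_ext {A : Type v} [AddCommGroup A] {f g : Tensor N M →+ A}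
    (h : ∀ (r : R) (n : N.obj (op r)) (m : M.obj r), f (tmul n m) = g (tmul n m)) : f = g := by
  apply QuotientAddGroup.addMonoidHom_ext
  apply FreeAbelianGroup.lift_ext
  rintro ⟨r, n, m⟩
  exact h r n m

/-- Functoriality of `N ⊗_R M` in both variables. -/
def tensorMap {N N' : Rᵒᵖ ⥤ AddCommGrpCat.{u}} {M M' : R ⥤ AddCommGrpCat.{u}}
    (g : N ⟶ N') (f : M ⟶ M') : Tensor N M →+ Tensor N' M' :=
  tensorLift (fun r n m => tmul (g.app (op r) n) (f.app r m))
    (by intro r n n' m; rw [map_add, add_tmul])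
    (by intro r n m m'; rw [map_add, tmul_add])
    (by
      intro r s k n m
      rw [NatTrans.naturality_apply, NatTrans.naturality_apply, tmul_balanced])

@[simp]
lemma tensorMap_tmul {N N' : Rᵒᵖ ⥤ AddCommGrpCat.{u}} {M M' : R ⥤ AddCommGrpCat.{u}}
    (g : N ⟶ N') (f : M ⟶ M') {r : R} (n : N.obj (op r)) (m : M.obj r) :
    tensorMap g f (tmul n m) = tmul (g.app (op r) n) (f.app r m) := by
  simp [tensorMap]

end Tensor

section TensorFunctor

variable {R : Type u} [SmallCategory R] [Preadditive R]

/-- The functor `N ⊗_R - : R-Mod ⥤ Ab`. -/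
def tensorFunctor (N : RMod R) : LMod R ⥤ AddCommGrpCat.{u} where
  obj M := AddCommGrpCat.of (Tensor N.obj M.obj)
  map f := AddCommGrpCat.ofHom (tensorMap (𝟙 N.obj) f.hom)
  map_id M := by
    ext : 1
    exact tensor_hom_ext fun r n m => by simp
  map_comp f g := by
    ext : 1
    exact tensor_hom_ext fun r n m => by simp

/-- The natural transformation `g ⊗_R - : N ⊗_R - ⟶ N' ⊗_R -`. -/
def tensorNatTrans {N N' : RMod R} (g : N ⟶ N') : tensorFunctor N ⟶ tensorFunctor N' where
  app M := AddCommGrpCat.ofHom (tensorMap g.hom (𝟙 M.obj))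
  naturality M M' f := by
    ext : 1
    refine tensor_hom_ext fun r n m => ?_
    change tensorMap g.hom (𝟙 M'.obj) (tensorMap (𝟙 N.obj) f.hom (tmul n m)) =
      tensorMap (𝟙 N'.obj) f.hom (tensorMap g.hom (𝟙 M.obj) (tmul n m))
    simp

end TensorFunctor

/-! ### The functors `(F-)s` -/

section EvalAt

variable {R S : Type u} [SmallCategory R] [Preadditive R] [SmallCategory S] [Preadditive S]

/-- `(F-)s : R-Mod ⥤ Ab`, `M ↦ (F M) s`. -/
def evalAt (F : LMod R ⥤ LMod S) (s : S) : LMod R ⥤ AddCommGrpCat.{u} :=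
  F ⋙ AdditiveFunctor.forget S AddCommGrpCat.{u} ⋙ (evaluation S AddCommGrpCat.{u}).obj s

/-- The natural transformation `(F-)f : (F-)s ⟶ (F-)s'` for `f : s ⟶ s'`. -/
def evalAtMap (F : LMod R ⥤ LMod S) {s s' : S} (f : s ⟶ s') : evalAt F s ⟶ evalAt F s' where
  app M := (F.obj M).obj.map f
  naturality _ _ g := ((F.map g).hom.naturality f).symm

/-- The natural transformation `(α-)s : (F-)s ⟶ (G-)s` for `α : F ⟶ G`. -/
def evalAtNat {F G : LMod R ⥤ LMod S} (α : F ⟶ G) (s : S) : evalAt F s ⟶ evalAt G s where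
  app M := (α.app M).hom.app s
  naturality _ _ g := congrArg (fun k => k.hom.app s) (α.naturality g)

/-- The component at `M` of a natural transformation `y : (F-)s ⟶ N ⊗_R -`. -/
def component {F : LMod R ⥤ LMod S} {s : S} {N : RMod R} (y : evalAt F s ⟶ tensorFunctor N)
    (M : LMod R) : (F.obj M).obj.obj s →+ Tensor N.obj M.obj :=
  (y.app M).hom

/-- A natural transformation `(F-)s ⟶ N ⊗_R -` from its components. -/
def mkNat {F : LMod R ⥤ LMod S} {s : S} {N : RMod R}
    (φ : ∀ M : LMod R, (F.obj M).obj.obj s →+ Tensor N.obj M.obj)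
    (h : ∀ (M M' : LMod R) (k : M ⟶ M') (z : (F.obj M).obj.obj s),
      φ M' ((F.map k).hom.app s z) = tensorMap (𝟙 N.obj) k.hom (φ M z)) :
    evalAt F s ⟶ tensorFunctor N where
  app M := AddCommGrpCat.ofHom (φ M)
  naturality M M' k := by
    ext z
    exact h M M' k z

section

variable {F G : LMod R ⥤ LMod S} {s : S} {N : RMod R}

lemma component_ext {y y' : evalAt F s ⟶ tensorFunctor N}
    (h : ∀ M z, component y M z = component y' M z) : y = y' := by
  ext M z
  exact h M z

@[simp]
lemma component_mkNat (φ h) (M : LMod R) (z : (F.obj M).obj.obj s) :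
    component (mkNat (N := N) φ h) M z = φ M z := rfl

@[simp]
lemma component_add (y y' : evalAt F s ⟶ tensorFunctor N) (M : LMod R) (z : (F.obj M).obj.obj s) :
    component (y + y') M z = component y M z + component y' M z := rfl

lemma component_map (y : evalAt F s ⟶ tensorFunctor N) {M M' : LMod R} (k : M ⟶ M')
    (z : (F.obj M).obj.obj s) :
    component y M' ((F.map k).hom.app s z) = tensorMap (𝟙 N.obj) k.hom (component y M z) :=
  ConcreteCategory.congr_hom (y.naturality k) z

@[simp]
lemma component_tensorNatTrans (y : evalAt F s ⟶ tensorFunctor N) {N' : RMod R} (g : N ⟶ N')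
    (M : LMod R) (z : (F.obj M).obj.obj s) :
    component (y ≫ tensorNatTrans g) M z = tensorMap g.hom (𝟙 M.obj) (component y M z) := rfl

@[simp]
lemma component_evalAtMap {s' : S} (f : s ⟶ s') (y : evalAt F s' ⟶ tensorFunctor N)
    (M : LMod R) (z : (F.obj M).obj.obj s) :
    component (evalAtMap F f ≫ y) M z = component y M ((F.obj M).obj.map f z) := rfl

@[simp]
lemma component_evalAtNat (α : F ⟶ G) (y : evalAt G s ⟶ tensorFunctor N)
    (M : LMod R) (z : (F.obj M).obj.obj s) :
    component (evalAtNat α s ≫ y) M z = component y M ((α.app M).hom.app s z) := rfl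

end

end EvalAt

/-! ### The 2-category of module categories and accessible additive functors -/

/-- Small preadditive categories, the 0-cells of `MODCAT`. -/
structure MODCAT : Type (u + 1) where
  carrier : Type u
  [category : SmallCategory carrier]
  [preadditive : Preadditive carrier]

attribute [instance] MODCAT.category MODCAT.preadditive

instance : CoeSort MODCAT.{u} (Type u) := ⟨MODCAT.carrier⟩

/-- The opposite of a small preadditive category. -/
abbrev MODCAT.opp (R : MODCAT.{u}) : MODCAT.{u} := ⟨(R : Type u)ᵒᵖ⟩

/-- 1-cells `R ⟶ S` of `MODCAT`: additive functors `R-Mod ⥤ S-Mod` that are accessible, that is,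
preserve `κ`-filtered colimits for some regular cardinal `κ`. (Module categories are locally
finitely presentable, hence `κ`-accessible for every regular cardinal `κ`.) -/
structure OneCell (R S : MODCAT.{u}) where
  functor : LMod R ⥤ LMod S
  additive : functor.Additive
  accessible : Functor.IsAccessible.{u} functor

/-- 2-cells of `MODCAT`: natural transformations. -/
@[ext]
structure TwoCell {R S : MODCAT.{u}} (F G : OneCell R S) where
  nat : F.functor ⟶ G.functor

lemma isAccessible_comp {R S T : MODCAT.{u}} {F : LMod R ⥤ LMod S} {G : LMod S ⥤ LMod T}
    (hF : Functor.IsAccessible.{u} F) (hG : Functor.IsAccessible.{u} G) :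
    Functor.IsAccessible.{u} (F ⋙ G) := by
  obtain ⟨κ, _, _⟩ := hF
  obtain ⟨κ', _, _⟩ := hG
  rcases le_total κ κ' with h | h
  · have := F.isCardinalAccessible_of_le h
    exact ⟨κ', inferInstance, inferInstance⟩
  · have := G.isCardinalAccessible_of_le h
    exact ⟨κ, inferInstance, inferInstance⟩

/-- Composition of 1-cells is in diagrammatic order: `F ≫ G` is `M ↦ G (F M)`. -/
@[simps id_functor comp_functor]
instance modcatStruct : CategoryStruct MODCAT.{u} where
  Hom R S := OneCell R S
  id R := ⟨𝟭 (LMod R), inferInstance, Cardinal.aleph0, ⟨Cardinal.isRegular_aleph0⟩, inferInstance⟩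
  comp F G := ⟨F.functor ⋙ G.functor,
    have := F.additive
    have := G.additive
    inferInstance,
    isAccessible_comp F.accessible G.accessible⟩

@[simps id_nat comp_nat]
instance modcatHom (R S : MODCAT.{u}) : Category (R ⟶ S) where
  Hom F G := TwoCell F G
  id F := ⟨𝟙 F.functor⟩
  comp α β := ⟨α.nat ≫ β.nat⟩

@[ext]
lemma two_cell_ext {R S : MODCAT.{u}} {F G : R ⟶ S} {α β : F ⟶ G}
    (h : α.nat = β.nat) : α = β :=
  TwoCell.ext h

/-- Invertible 2-cells from natural isomorphisms. -/
@[simps]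
def isoCell {R S : MODCAT.{u}} {F G : R ⟶ S} (e : F.functor ≅ G.functor) : F ≅ G where
  hom := ⟨e.hom⟩
  inv := ⟨e.inv⟩

@[simps whiskerLeft_nat whiskerRight_nat associator leftUnitor rightUnitor]
instance modcatBicategory : Bicategory MODCAT.{u} where
  homCategory R S := inferInstance
  whiskerLeft F _ _ α := TwoCell.mk (Functor.whiskerLeft F.functor α.nat)
  whiskerRight α G := TwoCell.mk (Functor.whiskerRight α.nat G.functor)
  associator F G H := isoCell (F := (F ≫ G) ≫ H) (G := F ≫ G ≫ H)
    (Functor.associator F.functor G.functor H.functor)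
  leftUnitor {R _} F := isoCell (F := 𝟙 R ≫ F) (G := F) (Functor.leftUnitor F.functor)
  rightUnitor {_ S} F := isoCell (F := F ≫ 𝟙 S) (G := F) (Functor.rightUnitor F.functor)

instance : Bicategory.Strict MODCAT.{u} where
  leftUnitor_eqToIso _ := rfl
  rightUnitor_eqToIso _ := rfl
  associator_eqToIso _ _ _ := rfl

/-! ### Reversing 2-cells -/

/-- `Bᶜᵒ`: the bicategory `B` with the 2-cells reversed. -/
structure Co (B : Type u) where
  unco : B

/-- A 1-cell of `Bᶜᵒ` is a 1-cell of `B`, in the same direction. -/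
structure CoOneCell {B : Type u} [Bicategory.{w, v} B] (a b : Co B) where
  unco : a.unco ⟶ b.unco

/-- A 2-cell `f ⟶ g` of `Bᶜᵒ` is a 2-cell `g ⟶ f` of `B`. -/
@[ext]
structure CoTwoCell {B : Type u} [Bicategory.{w, v} B] {a b : Co B} (f g : CoOneCell a b) where
  unco : g.unco ⟶ f.unco

section Co

variable {B : Type u} [Bicategory.{w, v} B]

@[simps id_unco comp_unco]
instance coStruct : CategoryStruct (Co B) where
  Hom a b := CoOneCell a b
  id a := ⟨𝟙 a.unco⟩
  comp f g := ⟨f.unco ≫ g.unco⟩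

@[simps id_unco comp_unco]
instance coHom (a b : Co B) : Category (a ⟶ b) where
  Hom f g := CoTwoCell f g
  id f := ⟨𝟙 f.unco⟩
  comp η θ := ⟨θ.unco ≫ η.unco⟩

@[ext]
lemma co_two_cell_ext {a b : Co B} {f g : a ⟶ b} {η θ : f ⟶ g} (h : η.unco = θ.unco) : η = θ :=
  CoTwoCell.ext h

/-- Invertible 2-cells of `Bᶜᵒ` from invertible 2-cells of `B`. -/
@[simps]
def coIso {a b : Co B} {f g : a ⟶ b} (e : f.unco ≅ g.unco) : f ≅ g where
  hom := ⟨e.inv⟩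
  inv := ⟨e.hom⟩

@[simps whiskerLeft_unco whiskerRight_unco associator leftUnitor rightUnitor]
instance coBicategory : Bicategory (Co B) where
  homCategory a b := inferInstance
  whiskerLeft f _ _ η := CoTwoCell.mk (f.unco ◁ η.unco)
  whiskerRight η h := CoTwoCell.mk (η.unco ▷ h.unco)
  associator f g h := coIso (f := (f ≫ g) ≫ h) (g := f ≫ g ≫ h) (α_ f.unco g.unco h.unco)
  leftUnitor {a _} f := coIso (f := 𝟙 a ≫ f) (g := f) (λ_ f.unco)
  rightUnitor {_ b} f := coIso (f := f ≫ 𝟙 b) (g := f) (ρ_ f.unco)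
  whisker_exchange η θ := by
    ext
    simpa using (whisker_exchange η.unco θ.unco).symm

end Co

instance : Bicategory.Strict (Co MODCAT.{u}) where
  leftUnitor_eqToIso _ := rfl
  rightUnitor_eqToIso _ := rfl
  associator_eqToIso _ _ _ := rfl

/-! ### The Auslander-Gruson-Jensen dual of a 1-cell -/

/-- An Auslander-Gruson-Jensen dual of an accessible additive functor `F : R-Mod ⥤ S-Mod`: an
accessible additive functor `DF : Mod-R ⥤ Mod-S` together with isomorphisms of abelian groups
`((DF) N) s ≃ ((F-)s, N ⊗_R -)`, natural in `N` and in `s`.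

The group `((F-)s, N ⊗_R -)` of all natural transformations is indexed by the large category
`R-Mod`, so it lives one universe up; the isomorphism expresses that `((DF) N) s` is that group.
It determines `DF` up to a unique isomorphism. -/
structure AGJDual {R S : MODCAT.{u}} (F : R ⟶ S) where
  cell : R.opp ⟶ S.opp
  equiv (N : RMod R) (s : S) :
    (cell.functor.obj N).obj.obj (op s) ≃+ (evalAt F.functor s ⟶ tensorFunctor N)
  equiv_map_left {N N' : RMod R} (g : N ⟶ N') (s : S)
    (x : (cell.functor.obj N).obj.obj (op s)) :
    equiv N' s ((cell.functor.map g).hom.app (op s) x) = equiv N s x ≫ tensorNatTrans g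
  equiv_map_right (N : RMod R) {s s' : S} (f : s ⟶ s')
    (x : (cell.functor.obj N).obj.obj (op s')) :
    equiv N s ((cell.functor.obj N).obj.map f.op x) = evalAtMap F.functor f ≫ equiv N s' x

/-- A 2-cell of `MODCAT` from its components. -/
def mkTwoCell {R S : MODCAT.{u}} {A B : R ⟶ S}
    (φ : ∀ (N : LMod R) (s : S), (A.functor.obj N).obj.obj s →+ (B.functor.obj N).obj.obj s)
    (h₁ : ∀ (N N' : LMod R) (g : N ⟶ N') (s : S) (x : (A.functor.obj N).obj.obj s),
      φ N' s ((A.functor.map g).hom.app s x) = (B.functor.map g).hom.app s (φ N s x))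
    (h₂ : ∀ (N : LMod R) (s s' : S) (f : s ⟶ s') (x : (A.functor.obj N).obj.obj s),
      φ N s' ((A.functor.obj N).obj.map f x) = (B.functor.obj N).obj.map f (φ N s x)) :
    A ⟶ B :=
  TwoCell.mk
    { app N := ObjectProperty.homMk
        { app s := AddCommGrpCat.ofHom (φ N s)
          naturality s s' f := by
            ext x
            exact h₂ N s s' f x }
      naturality N N' g := by
        apply ObjectProperty.hom_ext
        ext s x
        exact h₁ N N' g s x }

section Dual

variable {R S T : MODCAT.{u}}

/-- The action of `D` on 2-cells: `α : F ⟶ G` induces `Dα : DG ⟶ DF`, which sends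
`x : (G-)s ⟶ N ⊗_R -` to the composite of `(α-)s : (F-)s ⟶ (G-)s` with `x`. -/
def dualTwoCell {F G : R ⟶ S} (dF : AGJDual F) (dG : AGJDual G) (α : F ⟶ G) :
    dG.cell ⟶ dF.cell :=
  mkTwoCell
    (fun N s => AddMonoidHom.mk'
      (fun x => (dF.equiv N s.unop).symm (evalAtNat α.nat s.unop ≫ dG.equiv N s.unop x))
      (fun x y => by rw [map_add, Preadditive.comp_add, map_add]))
    (by
      intro N N' g s x
      apply (dF.equiv N' s.unop).injective
      have h₁ := dG.equiv_map_left g s.unop x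
      have h₂ := dF.equiv_map_left g s.unop
        ((dF.equiv N s.unop).symm (evalAtNat α.nat s.unop ≫ dG.equiv N s.unop x))
      rw [AddEquiv.apply_symm_apply] at h₂
      refine ((AddEquiv.apply_symm_apply _ _).trans ?_).trans h₂.symm
      exact (congrArg (fun k => evalAtNat α.nat s.unop ≫ k) h₁).trans
        (Category.assoc _ _ _).symm)
    (by
      intro N s s' f x
      apply (dF.equiv N s'.unop).injective
      have h₁ := dG.equiv_map_right N f.unop x
      have h₂ := dF.equiv_map_right N f.unop
        ((dF.equiv N s.unop).symm (evalAtNat α.nat s.unop ≫ dG.equiv N s.unop x))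
      rw [AddEquiv.apply_symm_apply] at h₂
      refine ((AddEquiv.apply_symm_apply _ _).trans ?_).trans h₂.symm
      refine (congrArg (fun k => evalAtNat α.nat s'.unop ≫ k) h₁).trans ?_
      refine component_ext fun M z => ?_
      exact congrArg (component (dG.equiv N s.unop x) M)
        (ConcreteCategory.congr_hom ((α.nat.app M).hom.naturality f.unop) z).symm)

/-- The evaluation `β_{N,F} : (DF)N ⊗_S (F M) ⟶ N ⊗_R M`, `a ⊗ z ↦ a_M(z)`. -/
def dualEval {F : R ⟶ S} (dF : AGJDual F) (N : RMod R) (M : LMod R) :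
    Tensor (dF.cell.functor.obj N).obj (F.functor.obj M).obj →+ Tensor N.obj M.obj :=
  tensorLift (fun s a z => component (dF.equiv N s a) M z)
    (fun s a a' z => by rw [map_add, component_add])
    (fun s a z z' => map_add _ _ _)
    (fun s s' f a z => by rw [dF.equiv_map_right, component_evalAtMap])

@[simp]
lemma dualEval_tmul {F : R ⟶ S} (dF : AGJDual F) (N : RMod R) (M : LMod R) {s : S}
    (a : (dF.cell.functor.obj N).obj.obj (op s)) (z : (F.functor.obj M).obj.obj s) :
    dualEval dF N M (tmul a z) = component (dF.equiv N s a) M z :=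
  tensorLift_tmul _ _ _ _ _ _

lemma dualEval_natural_right {F : R ⟶ S} (dF : AGJDual F) (N : RMod R) {M M' : LMod R}
    (k : M ⟶ M') (t : Tensor (dF.cell.functor.obj N).obj (F.functor.obj M).obj) :
    dualEval dF N M' (tensorMap (𝟙 _) (F.functor.map k).hom t) =
      tensorMap (𝟙 N.obj) k.hom (dualEval dF N M t) := by
  refine DFunLike.congr_fun (f := (dualEval dF N M').comp (tensorMap (𝟙 _) (F.functor.map k).hom))
    (g := (tensorMap (𝟙 N.obj) k.hom).comp (dualEval dF N M)) (tensor_hom_ext fun s a z => ?_) t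
  simp only [AddMonoidHom.comp_apply, tensorMap_tmul, dualEval_tmul, NatTrans.id_app]
  exact component_map (dF.equiv N s a) k z

lemma dualEval_natural_left {F : R ⟶ S} (dF : AGJDual F) {N N' : RMod R} (g : N ⟶ N')
    (M : LMod R) (t : Tensor (dF.cell.functor.obj N).obj (F.functor.obj M).obj) :
    dualEval dF N' M (tensorMap (dF.cell.functor.map g).hom (𝟙 _) t) =
      tensorMap g.hom (𝟙 M.obj) (dualEval dF N M t) := by
  refine DFunLike.congr_fun
    (f := (dualEval dF N' M).comp (tensorMap (dF.cell.functor.map g).hom (𝟙 _)))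
    (g := (tensorMap g.hom (𝟙 M.obj)).comp (dualEval dF N M)) (tensor_hom_ext fun s a z => ?_) t
  simp only [AddMonoidHom.comp_apply, tensorMap_tmul, dualEval_tmul, NatTrans.id_app]
  refine (DFunLike.congr_fun (congrArg (fun y => component y M) (dF.equiv_map_left g s a)) _).trans ?_
  simp

/-- The natural transformation `β_{N,F} ∘ (y * F) : (G(F-))t ⟶ N ⊗_R -` for a natural
transformation `y : (G-)t ⟶ (DF)N ⊗_S -`. -/
def deltaNat {F : R ⟶ S} (dF : AGJDual F) (G : S ⟶ T) (N : RMod R) (t : T)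
    (y : evalAt G.functor t ⟶ tensorFunctor (dF.cell.functor.obj N)) :
    evalAt (F ≫ G).functor t ⟶ tensorFunctor N :=
  mkNat (fun M => (dualEval dF N M).comp (component y (F.functor.obj M)))
    (fun M M' k z => by
      refine (congrArg (dualEval dF N M') (component_map y (F.functor.map k) z)).trans ?_
      exact dualEval_natural_right dF N k _)

/-- The comparison `δ_{G,F} : (DG)(DF) ⟶ D(GF)`. In diagrammatic order, `GF` is `F ≫ G` and
`(DG)(DF)` is `DF ≫ DG`. -/
def delta {F : R ⟶ S} {G : S ⟶ T} (dF : AGJDual F) (dG : AGJDual G) (dGF : AGJDual (F ≫ G)) :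
    dF.cell ≫ dG.cell ⟶ dGF.cell :=
  mkTwoCell
    (fun N t => AddMonoidHom.mk'
      (fun x => (dGF.equiv N t.unop).symm
        (deltaNat dF G N t.unop (dG.equiv (dF.cell.functor.obj N) t.unop x)))
      (fun x y => by
        refine (congrArg _ ?_).trans (map_add (dGF.equiv N t.unop).symm _ _)
        rw [map_add]
        refine component_ext (F := (F ≫ G).functor) (N := N) fun M z => ?_
        exact map_add (dualEval dF N M) _ _))
    (by
      intro N N' g t x
      apply (dGF.equiv N' t.unop).injective
      have h₁ := dG.equiv_map_left (dF.cell.functor.map g) t.unop x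
      have h₂ := dGF.equiv_map_left g t.unop ((dGF.equiv N t.unop).symm
        (deltaNat dF G N t.unop (dG.equiv (dF.cell.functor.obj N) t.unop x)))
      rw [AddEquiv.apply_symm_apply] at h₂
      refine ((AddEquiv.apply_symm_apply _ _).trans ?_).trans h₂.symm
      refine (congrArg (deltaNat dF G N' t.unop) h₁).trans ?_
      exact component_ext fun M z => dualEval_natural_left dF g M _)
    (by
      intro N t t' f x
      apply (dGF.equiv N t'.unop).injective
      have h₁ := dG.equiv_map_right (dF.cell.functor.obj N) f.unop x
      have h₂ := dGF.equiv_map_right N f.unop ((dGF.equiv N t.unop).symm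
        (deltaNat dF G N t.unop (dG.equiv (dF.cell.functor.obj N) t.unop x)))
      rw [AddEquiv.apply_symm_apply] at h₂
      refine ((AddEquiv.apply_symm_apply _ _).trans ?_).trans h₂.symm
      exact congrArg (deltaNat dF G N t'.unop) h₁)

/-- The natural transformation `(1_R -)r ⟶ N ⊗_R -`, `y ↦ x ⊗ y`, for `x ∈ N r`. -/
def psiNat (N : RMod R) (r : R) (x : N.obj.obj (op r)) :
    evalAt (𝟙 R : R ⟶ R).functor r ⟶ tensorFunctor N :=
  mkNat (fun M => AddMonoidHom.mk' (fun y : M.obj.obj r => tmul x y) (fun y y' => tmul_add x y y'))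
    (fun M M' k z => by
      refine Eq.trans ?_ (tensorMap_tmul (𝟙 N.obj) k.hom x z).symm
      rfl)

/-- The unit `ψ_R : 1_{Rᵒᵖ} ⟶ D(1_R)`, `x ↦ (y ↦ x ⊗ y)`. -/
def psi (d : AGJDual (𝟙 R)) : 𝟙 R.opp ⟶ d.cell :=
  mkTwoCell
    (fun N r => AddMonoidHom.mk' (fun x => (d.equiv N r.unop).symm (psiNat N r.unop x))
      (fun x y => by
        rw [← map_add]
        congr 1
        exact component_ext fun M z => add_tmul (M := M.obj) x y z))
    (by
      intro N N' g r x
      apply (d.equiv N' r.unop).injective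
      have h₂ := d.equiv_map_left g r.unop ((d.equiv N r.unop).symm (psiNat N r.unop x))
      rw [AddEquiv.apply_symm_apply] at h₂
      refine ((AddEquiv.apply_symm_apply _ _).trans ?_).trans h₂.symm
      refine component_ext fun M z => ?_
      refine Eq.trans ?_ (tensorMap_tmul g.hom (𝟙 M.obj) x z).symm
      rfl)
    (by
      intro N r r' f x
      apply (d.equiv N r'.unop).injective
      have h₂ := d.equiv_map_right N f.unop ((d.equiv N r.unop).symm (psiNat N r.unop x))
      rw [AddEquiv.apply_symm_apply] at h₂
      refine ((AddEquiv.apply_symm_apply _ _).trans ?_).trans h₂.symm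
      exact component_ext fun M z => tmul_balanced f.unop x z)

end Dual

/-- A choice of an Auslander-Gruson-Jensen dual for every 1-cell. -/
abbrev AGJChoice := ∀ {R S : MODCAT.{u}} (F : R ⟶ S), AGJDual F

/-- The action of `D` on 0-cells, 1-cells and 2-cells. It sends `R` to `Rᵒᵖ`, `F` to `DF`, and is
functorial on 2-cells. -/
def dualPrelax (𝒟 : AGJChoice.{u}) : PrelaxFunctor (Co MODCAT.{u}) MODCAT.{u} where
  obj R := R.unco.opp
  map F := (𝒟 F.unco).cell
  map₂ {R S F G} α := dualTwoCell (𝒟 G.unco) (𝒟 F.unco) α.unco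
  map₂_id {R S} F := by
    apply two_cell_ext
    ext N s x
    apply ((𝒟 F.unco).equiv N s.unop).injective
    refine (AddEquiv.apply_symm_apply _ _).trans ?_
    rfl
  map₂_comp {R S F G H} α β := by
    apply two_cell_ext
    ext N s x
    apply ((𝒟 H.unco).equiv N s.unop).injective
    refine (AddEquiv.apply_symm_apply _ _).trans ?_
    refine Eq.trans ?_ (AddEquiv.apply_symm_apply _ _).symm
    refine Eq.trans ?_ (congrArg (fun k => evalAtNat β.unco.nat s.unop ≫ k)
      (AddEquiv.apply_symm_apply _ _).symm)
    rfl

end AGJ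
end

/-! A transformation out of an accessible functor is determined by a small amount of data. Module
categories are locally `κ`-presentable for every regular `κ`, so if `F` is `κ`-accessible, each
`(F-)s` is the left Kan extension of its restriction to a small category `D` of `κ`-presentable
modules. Hence `((F-)s, N ⊗ -)` is the group of transformations between the restrictions to `D`
(`SmallPresentable.restrictEquiv`), which is small and serves as `(DF)N` at `s`. Accessibility of
`DF` has two sources: `N ↦ (N ⊗ -)|_D` preserves colimits, each `- ⊗ M` being a left adjoint; and
the objects `(F-)s|_D` of the locally presentable category `D ⥤ Ab` are presentable, for one common
cardinal because `s` ranges over a set.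

For the 2-categorical part, an element `x` of `(DF)N` is known by its values `x_M(z)`, which the
evaluation `β` collects. Three identities carry the lax axioms: `β_F (Dα ⊗ 1) = β_G (1 ⊗ α)` for `α
: F ⟶ G`, `β_{GF} (δ ⊗ 1) = β_F β_G`, and `β_1 (ψ ⊗ 1) = 1`. With the naturality of `x`, they reduce
both sides of each axiom to the same value.

For a comonad `L`, the same identities give `β (η ⊗ 1) = 1 ⊗ ε` and `β (μ ⊗ 1) = β β (1 ⊗ Δ)`, so
each monad law for `DL` becomes a comonad law for `L` applied to `z`. -/

noncomputable section

namespace AGJ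

open Limits

/-! ### Local presentability from corepresentable functors -/

section LocallyPresentable

/-- A cocomplete category with a small family of `κ`-accessible corepresentable functors which are
jointly faithful and conservative is locally `κ`-presentable. -/
lemma isCardinalLocallyPresentable_of_corepresentable {C : Type v} [Category.{w} C]
    [HasColimitsOfSize.{w, w} C] (κ : Cardinal.{w}) [Fact κ.IsRegular] {I : Type w}
    (G : I → C) (U : I → C ⥤ Type w) (e : ∀ i, coyoneda.obj (op (G i)) ≅ U i)
    (hU : ∀ i, (U i).IsCardinalAccessible κ)
    (faithful : ∀ {X Y : C} (f g : X ⟶ Y), (∀ i, (U i).map f = (U i).map g) → f = g)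
    (conservative : ∀ {X Y : C} (f : X ⟶ Y), (∀ i, IsIso ((U i).map f)) → IsIso f) :
    IsCardinalLocallyPresentable C κ := by
  rw [IsCardinalLocallyPresentable.iff_exists_isStrongGenerator]
  refine ⟨ObjectProperty.ofObj G, inferInstance, ?_, ?_⟩
  · rw [ObjectProperty.isStrongGenerator_iff]
    refine ⟨fun X Y f g h => faithful f g fun i => ?_, fun X Y f _ h => conservative f fun i => ?_⟩
    · have h' : (coyoneda.obj (op (G i))).map f = (coyoneda.obj (op (G i))).map g := by
        ext k
        exact h (G i) ⟨i⟩ k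
      rw [← cancel_epi ((e i).hom.app X), ← (e i).hom.naturality, ← (e i).hom.naturality, h']
    · have : IsIso ((coyoneda.obj (op (G i))).map f) := by
        rw [isIso_iff_bijective]
        exact ⟨fun a b hab => (cancel_mono f).1 hab, h (G i) ⟨i⟩⟩
      exact (NatIso.isIso_map_iff (e i) f).1 this
  -- `G i` is `κ`-presentable because the functor it corepresents is isomorphic to the
  -- `κ`-accessible `U i`.
  · rintro _ ⟨i⟩
    exact Functor.isCardinalAccessible_of_natIso (e i).symm κ

/-- A `κ`-filtered category is filtered, and filtered colimits of abelian groups are computed on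
underlying sets. -/
instance isCardinalAccessible_forget_addCommGrpCat (κ : Cardinal.{u}) [Fact κ.IsRegular] :
    (forget AddCommGrpCat.{u}).IsCardinalAccessible κ where
  preservesColimitOfShape J _ _ := by
    have := isFiltered_of_isCardinalFiltered J κ
    infer_instance

instance isCardinalLocallyPresentable_addCommGrpCat (κ : Cardinal.{u}) [Fact κ.IsRegular] :
    IsCardinalLocallyPresentable AddCommGrpCat.{u} κ :=
  isCardinalLocallyPresentable_of_corepresentable κ (I := PUnit)
    (fun _ => AddCommGrpCat.of (ULift.{u} ℤ)) (fun _ => forget AddCommGrpCat.{u})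
    (fun _ => AddCommGrpCat.coyonedaObjIsoForget)
    (fun _ => inferInstance)
    (fun _ _ h => (forget AddCommGrpCat.{u}).map_injective (h ⟨⟩))
    (fun f h => have := h ⟨⟩; isIso_of_reflects_iso f (forget AddCommGrpCat.{u}))

/-- Makes every functor `D ⥤ Ab` presentable, in particular the restrictions `(F-)s|_D`. -/
instance isLocallyPresentable_functor (D : Type u) [SmallCategory D] :
    IsLocallyPresentable.{u} (D ⥤ AddCommGrpCat.{u}) := by
  have : IsLocallyPresentable.{u} AddCommGrpCat.{u} :=
    ⟨_, Cardinal.fact_isRegular_aleph0, inferInstance⟩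
  -- Regards functors on `D` as presheaves on `Dᵒᵖ`.
  exact ((opOpEquivalence D).congrLeft (E := AddCommGrpCat.{u})).isLocallyPresentable

end LocallyPresentable

/-! ### Colimits and generators in module categories -/

section AdditiveFunctor

/-- Colimits of functors are pointwise, and the legs at `a` are jointly epimorphic, so additivity of
the colimit can be checked after composing with each leg, where it is additivity in the diagram. -/
instance additiveFunctor_isClosedUnderColimitsOfShape {C : Type*} [Category* C] [Preadditive C]
    (J : Type u) [SmallCategory J] :
    (additiveFunctor C AddCommGrpCat.{u}).IsClosedUnderColimitsOfShape J where
  colimitsOfShape_le := by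
    rintro X ⟨p⟩
    refine ⟨fun {a b f g} => ?_⟩
    refine (isColimitOfPreserves ((evaluation C AddCommGrpCat.{u}).obj a) p.isColimit).hom_ext
      fun j => ?_
    have : (p.diag.obj j).Additive := p.prop_diag_obj j
    have h (k : a ⟶ b) := (p.ι.app j).naturality k
    change (p.ι.app j).app a ≫ X.map (f + g) = (p.ι.app j).app a ≫ (X.map f + X.map g)
    refine (h (f + g)).symm.trans ?_
    rw [Preadditive.comp_add, Functor.map_add, Preadditive.add_comp]
    exact congrArg₂ _ (h f) (h g)

variable (R : Type u) [SmallCategory R] [Preadditive R]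

instance hasColimits_LMod : HasColimitsOfSize.{u, u} (LMod R) :=
  ⟨fun J _ => hasColimitsOfShape_of_closedUnderColimits J (additiveFunctor R AddCommGrpCat.{u})⟩

instance preservesColimits_forget_LMod :
    PreservesColimitsOfSize.{u, u} (AdditiveFunctor.forget R AddCommGrpCat.{u}) where
  preservesColimitsOfShape {J} _ := by
    have : CreatesColimitsOfShape J (additiveFunctor R AddCommGrpCat.{u}).ι := inferInstance
    infer_instance

/-- The functor `M ↦ M r`. -/
abbrev evalObj {R : Type u} [SmallCategory R] [Preadditive R] (r : R) :
    LMod R ⥤ AddCommGrpCat.{u} :=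
  AdditiveFunctor.forget R AddCommGrpCat.{u} ⋙ (evaluation R AddCommGrpCat.{u}).obj r

lemma isIso_of_forall_evalObj {M N : LMod R} (f : M ⟶ N) (h : ∀ r : R, IsIso ((evalObj r).map f)) :
    IsIso f := by
  have : IsIso ((AdditiveFunctor.forget R AddCommGrpCat.{u}).map f) := by
    rw [NatTrans.isIso_iff_isIso_app]
    exact h
  exact isIso_of_reflects_iso f (AdditiveFunctor.forget R AddCommGrpCat.{u})

/-- The Yoneda lemma for modules. -/
def yonedaModule {R : Type u} [SmallCategory R] [Preadditive R] (r : R) :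
    coyoneda.obj (op (AdditiveFunctor.of (preadditiveCoyoneda.obj (op r)) : LMod R)) ≅
      evalObj r ⋙ forget AddCommGrpCat.{u} :=
  NatIso.ofComponents (fun M => Equiv.toIso
    { toFun f := (f.hom.app r).hom (𝟙 r)
      invFun x := ObjectProperty.homMk
        { app s := AddCommGrpCat.ofHom (AddMonoidHom.mk' (fun k : r ⟶ s => (M.obj.map k).hom x)
            (fun k l => ConcreteCategory.congr_hom (M.obj.map_add (f := k) (g := l)) x))
          naturality s t g := by
            ext k
            exact ConcreteCategory.congr_hom (M.obj.map_comp k g) x }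
      left_inv f := by
        apply ObjectProperty.hom_ext
        ext s k
        refine (ConcreteCategory.congr_hom (f.hom.naturality k) (𝟙 r)).symm.trans ?_
        exact congrArg (f.hom.app s).hom (Category.id_comp k)
      right_inv x := ConcreteCategory.congr_hom (M.obj.map_id r) x })
    (fun f => rfl)

/-- The representable modules corepresent the evaluations, which preserve all small colimits. Having
this for every `κ` lets the cardinal supplied by an accessible functor be used unchanged. -/
instance isCardinalLocallyPresentable_LMod (κ : Cardinal.{u}) [Fact κ.IsRegular] :
    IsCardinalLocallyPresentable (LMod R) κ :=
  isCardinalLocallyPresentable_of_corepresentable κ _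
    (fun r : R => evalObj r ⋙ forget AddCommGrpCat.{u}) yonedaModule
    (fun _ => inferInstance)
    (fun f g h => by
      apply ObjectProperty.hom_ext
      ext r : 2
      exact (forget AddCommGrpCat.{u}).map_injective (h r))
    (fun f h => isIso_of_forall_evalObj R f fun r =>
      have : IsIso ((forget AddCommGrpCat.{u}).map ((evalObj r).map f)) := h r
      isIso_of_reflects_iso ((evalObj r).map f) (forget AddCommGrpCat.{u}))

end AdditiveFunctor

/-! ### Tensor-hom adjunction and colimits in the right module -/

section TensorAdjunction

variable {R : Type u} [SmallCategory R] [Preadditive R]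

/-- The functor `N ↦ N ⊗_R -`. -/
def tensorBifunctor (R : Type u) [SmallCategory R] [Preadditive R] :
    RMod R ⥤ LMod R ⥤ AddCommGrpCat.{u} where
  obj N := tensorFunctor N
  map g := tensorNatTrans g
  map_id N := by
    ext M : 3
    exact tensor_hom_ext fun r n m => tensorMap_tmul _ _ _ _
  map_comp g g' := by
    ext M : 3
    refine tensor_hom_ext fun r n m => (tensorMap_tmul _ _ _ _).trans ?_
    exact ((congrArg (tensorMap g'.hom (𝟙 M.obj)) (tensorMap_tmul g.hom (𝟙 M.obj) n m)).trans
      (tensorMap_tmul _ _ _ _)).symm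

/-- The right module `r ↦ Hom(M r, A)`. -/
def homModule (M : LMod R) (A : AddCommGrpCat.{u}) : RMod R where
  obj :=
    { obj r := AddCommGrpCat.of (M.obj.obj r.unop →+ A)
      map f := AddCommGrpCat.ofHom (AddMonoidHom.mk' (fun h => h.comp (M.obj.map f.unop).hom)
        (fun _ _ => rfl))
      map_id r := by
        ext h : 2
        refine AddMonoidHom.ext fun m => congrArg h ?_
        exact ConcreteCategory.congr_hom (M.obj.map_id r.unop) m
      map_comp f g := by
        ext h : 2
        refine AddMonoidHom.ext fun m => congrArg h ?_
        exact ConcreteCategory.congr_hom (M.obj.map_comp g.unop f.unop) m }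
  property := ⟨fun {r s f g} => by
    ext h : 2
    refine AddMonoidHom.ext fun m => ?_
    refine Eq.trans (congrArg h ?_) (map_add h _ _)
    exact ConcreteCategory.congr_hom (M.obj.map_add (f := f.unop) (g := g.unop)) m⟩

/-- The homomorphism `N r →+ Hom(M r, A)` induced by `N ⊗_R M →+ A`. -/
def tensorCurry {N : RMod R} {M : LMod R} {A : AddCommGrpCat.{u}}
    (f : Tensor N.obj M.obj →+ A) (r : R) : N.obj.obj (op r) →+ M.obj.obj r →+ A :=
  AddMonoidHom.mk' (fun n => AddMonoidHom.mk' (fun m => f (tmul n m))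
      (fun m m' => by rw [tmul_add, map_add]))
    (fun n n' => AddMonoidHom.ext fun m => (congrArg f (add_tmul n n' m)).trans (map_add f _ _))

/-- The homomorphism `N r →+ Hom(M r, A)` underlying a homomorphism `N ⟶ Hom(M, A)`. -/
def homModuleApp {N : RMod R} {M : LMod R} {A : AddCommGrpCat.{u}}
    (g : N ⟶ homModule M A) (r : R) : N.obj.obj (op r) →+ M.obj.obj r →+ A :=
  (g.hom.app (op r)).hom

lemma homModuleApp_naturality {N : RMod R} {M : LMod R} {A : AddCommGrpCat.{u}}
    (g : N ⟶ homModule M A) {r s : R} (k : r ⟶ s) (n : N.obj.obj (op s)) (m : M.obj.obj r) :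
    homModuleApp g r (N.obj.map k.op n) m = homModuleApp g s n (M.obj.map k m) :=
  DFunLike.congr_fun (F := M.obj.obj r →+ A)
    (ConcreteCategory.congr_hom (g.hom.naturality k.op) n) m

/-- The homomorphism `N ⊗_R M →+ A` induced by `N ⟶ Hom(M, A)`. -/
def tensorUncurry {N : RMod R} {M : LMod R} {A : AddCommGrpCat.{u}}
    (g : N ⟶ homModule M A) : Tensor N.obj M.obj →+ A :=
  tensorLift (fun r n m => homModuleApp g r n m)
    (fun r n n' m => by rw [map_add, AddMonoidHom.add_apply])
    (fun r n m m' => map_add _ _ _)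
    (fun r s k n m => homModuleApp_naturality g k n m)

lemma tensorUncurry_tmul {N : RMod R} {M : LMod R} {A : AddCommGrpCat.{u}}
    (g : N ⟶ homModule M A) {r : R} (n : N.obj.obj (op r)) (m : M.obj.obj r) :
    tensorUncurry g (tmul n m) = homModuleApp g r n m := by
  rw [tensorUncurry, tensorLift_tmul]

/-- The homomorphism `N ⟶ Hom(M, A)` of right modules induced by `N ⊗_R M →+ A`. -/
def tensorCurryHom {N : RMod R} {M : LMod R} {A : AddCommGrpCat.{u}}
    (f : Tensor N.obj M.obj →+ A) : N ⟶ homModule M A :=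
  ObjectProperty.homMk
    { app r := AddCommGrpCat.ofHom (tensorCurry f r.unop)
      naturality r s k := by
        ext n : 2
        exact AddMonoidHom.ext fun m => congrArg f (tmul_balanced (N := N.obj) k.unop n m) }

lemma tensorUncurry_tensorCurryHom {N : RMod R} {M : LMod R} {A : AddCommGrpCat.{u}}
    (f : Tensor N.obj M.obj →+ A) : tensorUncurry (tensorCurryHom f) = f :=
  tensor_hom_ext fun _ n m => tensorUncurry_tmul (tensorCurryHom f) n m

lemma tensorCurryHom_tensorUncurry {N : RMod R} {M : LMod R} {A : AddCommGrpCat.{u}}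
    (g : N ⟶ homModule M A) : tensorCurryHom (tensorUncurry g) = g := by
  apply ObjectProperty.hom_ext
  ext r n : 4
  exact AddMonoidHom.ext fun (m : M.obj.obj r.unop) => tensorUncurry_tmul (r := r.unop) g n m

/-- Homomorphisms `N ⊗_R M ⟶ A` are homomorphisms `N ⟶ Hom(M, A)` of right modules. -/
def tensorHomEquiv (N : RMod R) (M : LMod R) (A : AddCommGrpCat.{u}) :
    ((tensorFunctor N).obj M ⟶ A) ≃ (N ⟶ homModule M A) where
  toFun f := tensorCurryHom f.hom
  invFun g := AddCommGrpCat.ofHom (tensorUncurry g)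
  left_inv f := AddCommGrpCat.hom_ext (tensorUncurry_tensorCurryHom f.hom)
  right_inv g := tensorCurryHom_tensorUncurry g

/-- The functor `N ↦ N ⊗_R M` has a right adjoint. -/
def tensorAdjunction (M : LMod R) :=
  Adjunction.adjunctionOfEquivRight
    (F := tensorBifunctor R ⋙ (evaluation (LMod R) AddCommGrpCat.{u}).obj M)
    (fun N A => tensorHomEquiv N M A)
    (fun N' N A f g => by
      apply ObjectProperty.hom_ext
      ext r n : 4
      exact AddMonoidHom.ext fun (m : M.obj.obj r.unop) =>
        congrArg g.hom (tensorMap_tmul (r := r.unop) f.hom (𝟙 M.obj) n m))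

instance preservesColimits_tensorBifunctor_evaluation (M : LMod R) :
    PreservesColimitsOfSize.{u, u}
      (tensorBifunctor R ⋙ (evaluation (LMod R) AddCommGrpCat.{u}).obj M) :=
  (tensorAdjunction M).leftAdjoint_preservesColimits

/-- The functor `N ↦ (N ⊗_R -)|_D`. -/
abbrev restrictedTensor {D : Type u} [SmallCategory D] (G : D ⥤ LMod R) :
    RMod R ⥤ D ⥤ AddCommGrpCat.{u} :=
  tensorBifunctor R ⋙ (Functor.whiskeringLeft _ _ _).obj G

instance preservesColimits_restrictedTensor {D : Type u} [SmallCategory D] (G : D ⥤ LMod R) :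
    PreservesColimitsOfSize.{u, u} (restrictedTensor G) where
  preservesColimitsOfShape {J} _ :=
    preservesColimitsOfShape_of_evaluation _ _ fun d =>
      inferInstanceAs (PreservesColimitsOfShape J
        (tensorBifunctor R ⋙ (evaluation (LMod R) AddCommGrpCat.{u}).obj (G.obj d)))

end TensorAdjunction

/-! ### Restriction to presentable objects -/

section Restriction

variable (C : Type v) [Category.{u} C] (κ : Cardinal.{u}) [Fact κ.IsRegular]
  [IsCardinalLocallyPresentable C κ]

/-- A small category equivalent to the category of `κ`-presentable objects. -/
abbrev SmallPresentable : Type u :=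
  SmallModel.{u} (isCardinalPresentable C κ).FullSubcategory

/-- The inclusion of the `κ`-presentable objects. -/
abbrev SmallPresentable.incl : SmallPresentable C κ ⥤ C :=
  (equivSmallModel.{u} (isCardinalPresentable C κ).FullSubcategory).inverse ⋙
    (isCardinalPresentable C κ).ι

variable {C} {E : Type*} [Category* E]

/-- The category of `κ`-presentable objects over `X` is essentially small and `κ`-filtered; both
survive the passage to the small model, which only replaces it by an equivalent category. -/
lemma SmallPresentable.preservesColimitsOfShape (H : C ⥤ E) [H.IsCardinalAccessible κ] (X : C) :
    PreservesColimitsOfShape (CostructuredArrow (SmallPresentable.incl C κ) X) H := by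
  let e := (CostructuredArrow.pre
    (equivSmallModel.{u} (isCardinalPresentable C κ).FullSubcategory).inverse
    (isCardinalPresentable C κ).ι X).asEquivalence
  have : PreservesColimitsOfShape (CostructuredArrow (isCardinalPresentable C κ).ι X) H :=
    H.preservesColimitsOfShape_of_isCardinalAccessible_of_essentiallySmall κ _
  exact preservesColimitsOfShape_of_equiv e.symm H

/-- A `κ`-accessible functor is the left Kan extension of its restriction to the `κ`-presentable
objects. -/
lemma SmallPresentable.isLeftKanExtension (H : C ⥤ E) [H.IsCardinalAccessible κ] :
    H.IsLeftKanExtension (𝟙 (SmallPresentable.incl C κ ⋙ H)) := by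
  have h : (Functor.LeftExtension.mk H
      (𝟙 (SmallPresentable.incl C κ ⋙ H))).IsPointwiseLeftKanExtension := fun X => by
    -- By density, `X` is the colimit of the presentable objects over it, and `H` preserves this
    -- colimit: this is the pointwise Kan extension formula.
    have := SmallPresentable.preservesColimitsOfShape κ H X
    exact IsColimit.ofIsoColimit
      (isColimitOfPreserves H ((SmallPresentable.incl C κ).denseAt X))
      (Cocone.ext (Iso.refl _) (fun j => by
        refine (Category.comp_id _).trans ((congrArg H.map (Category.id_comp _)).trans ?_)
        exact (Category.id_comp _).symm))
  exact h.isLeftKanExtension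

/-- Natural transformations out of a `κ`-accessible functor are determined by their restriction to
the `κ`-presentable objects. -/
def SmallPresentable.restrictEquiv (H H' : C ⥤ AddCommGrpCat.{u}) [H.IsCardinalAccessible κ] :
    (H ⟶ H') ≃+ (SmallPresentable.incl C κ ⋙ H ⟶ SmallPresentable.incl C κ ⋙ H') :=
  have := SmallPresentable.isLeftKanExtension κ H
  AddEquiv.ofBijective
    (AddMonoidHom.mk' (fun y => Functor.whiskerLeft (SmallPresentable.incl C κ) y)
      (fun _ _ => rfl))
    (by
      -- As the unit of the Kan extension is an identity, its universal bijection is plain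
      -- restriction.
      convert (H.homEquivOfIsLeftKanExtension (𝟙 (SmallPresentable.incl C κ ⋙ H)) H').bijective
      ext y
      simp)

end Restriction

/-! ### Construction and accessibility of the dual functor -/

section DualFunctor

variable {R S : Type u} [SmallCategory R] [Preadditive R] [SmallCategory S] [Preadditive S]

lemma tensorMap_add_left {N N' : RMod R} (g g' : N ⟶ N') (M : LMod R) (t : Tensor N.obj M.obj) :
    tensorMap (g + g').hom (𝟙 M.obj) t =
      tensorMap g.hom (𝟙 M.obj) t + tensorMap g'.hom (𝟙 M.obj) t := by
  refine DFunLike.congr_fun (f := tensorMap (g + g').hom (𝟙 M.obj))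
    (g := tensorMap g.hom (𝟙 M.obj) + tensorMap g'.hom (𝟙 M.obj))
    (tensor_hom_ext fun r n m => ?_) t
  rw [AddMonoidHom.add_apply, tensorMap_tmul, tensorMap_tmul, tensorMap_tmul]
  exact add_tmul (g.hom.app (op r) n) (g'.hom.app (op r) n) m

lemma tensorNatTrans_add {N N' : RMod R} (g g' : N ⟶ N') :
    tensorNatTrans (g + g') = tensorNatTrans g + tensorNatTrans g' := by
  ext M t
  exact tensorMap_add_left g g' M t

lemma evalAtMap_add (F : LMod R ⥤ LMod S) {s s' : S} (f f' : s ⟶ s') :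
    evalAtMap F (f + f') = evalAtMap F f + evalAtMap F f' := by
  ext M : 2
  exact (F.obj M).obj.map_add

variable {D : Type u} [SmallCategory D] (G : D ⥤ LMod R) (F : LMod R ⥤ LMod S)

/-- The right module `s ↦ ((F-)s|_D, (N ⊗_R -)|_D)`. -/
def restrictedDualObj (N : RMod R) : RMod S where
  obj :=
    { obj s := AddCommGrpCat.of (G ⋙ evalAt F s.unop ⟶ G ⋙ tensorFunctor N)
      map f := AddCommGrpCat.ofHom (AddMonoidHom.mk'
        (fun y => Functor.whiskerLeft G (evalAtMap F f.unop) ≫ y)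
        (fun _ _ => Preadditive.comp_add _ _ _ _ _ _))
      map_id s := by
        ext y d z
        exact congrArg (y.app d).hom
          (ConcreteCategory.congr_hom ((F.obj (G.obj d)).obj.map_id s.unop) z)
      map_comp f g := by
        ext y d z
        exact congrArg (y.app d).hom
          (ConcreteCategory.congr_hom ((F.obj (G.obj d)).obj.map_comp g.unop f.unop) z) }
  property := ⟨fun {s s' f g} => by
    ext y : 2
    refine (congrArg (fun k => Functor.whiskerLeft G k ≫ y)
      (evalAtMap_add F f.unop g.unop)).trans ?_
    exact Preadditive.add_comp _ _ _ (Functor.whiskerLeft G (evalAtMap F f.unop))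
      (Functor.whiskerLeft G (evalAtMap F g.unop)) y⟩

/-- The functor `N ↦ (s ↦ ((F-)s|_D, (N ⊗_R -)|_D))`. -/
def restrictedDual : RMod R ⥤ RMod S where
  obj N := restrictedDualObj G F N
  map {N N'} g := ObjectProperty.homMk
    { app s := AddCommGrpCat.ofHom (AddMonoidHom.mk'
        (fun y : G ⋙ evalAt F s.unop ⟶ G ⋙ tensorFunctor N =>
          y ≫ Functor.whiskerLeft G (tensorNatTrans g))
        (fun _ _ => Preadditive.add_comp _ _ _ _ _ _))
      naturality _ _ _ := rfl }
  map_id N := by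
    apply ObjectProperty.hom_ext
    ext s y : 4
    exact (congrArg (CategoryStruct.comp (X := G ⋙ evalAt F s.unop) y)
      ((restrictedTensor G).map_id N)).trans (Category.comp_id (X := G ⋙ evalAt F s.unop) y)
  map_comp g g' := by
    apply ObjectProperty.hom_ext
    ext s y : 4
    exact (congrArg (CategoryStruct.comp (X := G ⋙ evalAt F s.unop) y)
      ((restrictedTensor G).map_comp g g')).trans
      (Category.assoc (W := G ⋙ evalAt F s.unop) y _ _).symm

instance restrictedDual_additive : (restrictedDual G F).Additive where
  map_add {N N' g g'} := by
    apply ObjectProperty.hom_ext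
    ext s y : 4
    refine (congrArg (fun k => _ ≫ Functor.whiskerLeft G k) (tensorNatTrans_add g g')).trans ?_
    exact Preadditive.comp_add _ _ _ _ (Functor.whiskerLeft G (tensorNatTrans g))
      (Functor.whiskerLeft G (tensorNatTrans g'))

/-- The underlying sets of `restrictedDual` are corepresented on `D ⥤ Ab`. -/
def restrictedDualEvalIso (s : Sᵒᵖ) :
    restrictedTensor G ⋙ coyoneda.obj (op (G ⋙ evalAt F s.unop)) ≅
      restrictedDual G F ⋙ evalObj s ⋙ forget AddCommGrpCat.{u} :=
  Iso.refl _

/-- A functor to modules preserves filtered colimits if its evaluations, as functors to types,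
do. -/
lemma preservesColimitsOfShape_of_evalObj_forget (H : LMod R ⥤ LMod S) (J : Type u)
    [SmallCategory J] [IsFiltered J]
    (h : ∀ s, PreservesColimitsOfShape J (H ⋙ evalObj s ⋙ forget AddCommGrpCat.{u})) :
    PreservesColimitsOfShape J H := by
  have (s : S) : PreservesColimitsOfShape J ((H ⋙ AdditiveFunctor.forget S AddCommGrpCat.{u}) ⋙
      (evaluation S AddCommGrpCat.{u}).obj s) :=
    have : PreservesColimitsOfShape J
      (((H ⋙ AdditiveFunctor.forget S AddCommGrpCat.{u}) ⋙
        (evaluation S AddCommGrpCat.{u}).obj s) ⋙ forget AddCommGrpCat.{u}) := h s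
    -- Filteredness of `J` enters here: the forgetful functor to sets preserves such colimits and
    -- reflects isomorphisms.
    have : ReflectsColimitsOfShape J (forget AddCommGrpCat.{u}) :=
      reflectsColimitsOfShape_of_reflectsIsomorphisms
    preservesColimitsOfShape_of_reflects_of_preserves _ (forget AddCommGrpCat.{u})
  have := preservesColimitsOfShape_of_evaluation
    (H ⋙ AdditiveFunctor.forget S AddCommGrpCat.{u}) J this
  exact preservesColimitsOfShape_of_reflects_of_preserves H
    (AdditiveFunctor.forget S AddCommGrpCat.{u})

/-- A small family of presentable objects is `κ`-presentable for a common `κ`. -/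
lemma exists_isCardinalPresentable {C : Type*} [Category* C] {I : Type u} (X : I → C)
    [∀ i, IsPresentable.{u} (X i)] :
    ∃ (κ : Cardinal.{u}) (_ : Fact κ.IsRegular), ∀ i, IsCardinalPresentable (X i) κ := by
  choose κ hκ h using fun i => Functor.IsAccessible.exists_cardinal (F := coyoneda.obj (op (X i)))
  -- The type `(κ i).ord.ToType` has cardinality `κ i`, so `κ'` is a regular cardinal above every `κ
  -- i`.
  obtain ⟨κ', hκ', h'⟩ := HasCardinalLT.exists_regular_cardinal_forall.{u}
    (fun i => (κ i).ord.ToType)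
  have : Fact κ'.IsRegular := ⟨hκ'⟩
  refine ⟨κ', this, fun i => ?_⟩
  have := h i
  exact Functor.isCardinalAccessible_of_le _
    (le_of_lt (by simpa [hasCardinalLT_iff_cardinal_mk_lt] using h' i) : κ i ≤ κ')

/-- Each evaluation is, on underlying sets, a colimit-preserving functor followed by `Hom` out of a
presentable object. Smallness of `S` allows a single cardinal for all `s`. -/
lemma restrictedDual_isAccessible : Functor.IsAccessible.{u} (restrictedDual G F) := by
  obtain ⟨κ, _, h⟩ := exists_isCardinalPresentable fun s : Sᵒᵖ => G ⋙ evalAt F s.unop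
  refine ⟨κ, inferInstance, ⟨fun J _ _ => ?_⟩⟩
  have := isFiltered_of_isCardinalFiltered J κ
  refine preservesColimitsOfShape_of_evalObj_forget _ J fun s => ?_
  have := preservesColimitsOfShape_of_isCardinalPresentable (G ⋙ evalAt F s.unop) κ J
  exact preservesColimitsOfShape_of_natIso (restrictedDualEvalIso G F s)

end DualFunctor

/-- Every accessible additive functor between module categories has an
Auslander-Gruson-Jensen dual. -/
theorem nonempty_agjDual {R S : MODCAT.{u}} (F : R ⟶ S) : Nonempty (AGJDual F) := by
  obtain ⟨κ, _, h⟩ := F.accessible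
  -- Evaluation at `s` preserves all small colimits, so the cardinal of `F` works for every `(F-)s`.
  have (s : S) : (evalAt F.functor s).IsCardinalAccessible κ := by
    unfold evalAt
    infer_instance
  let G := SmallPresentable.incl (LMod R) κ
  exact ⟨{
    cell := ⟨restrictedDual G F.functor, inferInstance, restrictedDual_isAccessible G F.functor⟩
    equiv N s :=
      (SmallPresentable.restrictEquiv κ (evalAt F.functor s) (tensorFunctor N)).symm
    equiv_map_left {N N'} g s x := by
      refine (AddEquiv.symm_apply_eq _).2 ?_
      -- Every transformation on `D` is the restriction of some `y` on all modules; naturality then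
      -- only says that restriction respects composition.
      obtain ⟨y, rfl⟩ := (SmallPresentable.restrictEquiv κ (evalAt F.functor s)
        (tensorFunctor N)).surjective x
      exact congrArg (fun k => SmallPresentable.restrictEquiv κ (evalAt F.functor s)
        (tensorFunctor N') (k ≫ tensorNatTrans g)) (AddEquiv.symm_apply_apply _ y).symm
    equiv_map_right N {s s'} f x := by
      refine (AddEquiv.symm_apply_eq _).2 ?_
      obtain ⟨y, rfl⟩ := (SmallPresentable.restrictEquiv κ (evalAt F.functor s')
        (tensorFunctor N)).surjective x
      exact congrArg (fun k => SmallPresentable.restrictEquiv κ (evalAt F.functor s)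
        (tensorFunctor N) (evalAtMap F.functor f ≫ k)) (AddEquiv.symm_apply_apply _ y).symm }⟩

/-! ### Values of the structure 2-cells and identities for evaluation -/

section DualCells

variable {R S T : MODCAT.{u}}

/-- The action of a 2-cell on elements. -/
def cellApp {A B : R ⟶ S} (a : A ⟶ B) (N : LMod R) (s : S) :
    (A.functor.obj N).obj.obj s →+ (B.functor.obj N).obj.obj s :=
  ((a.nat.app N).hom.app s).hom

/-- Since `d.equiv` is injective, a 2-cell into `DF` is determined by the values `x_M(z)` of the
transformations it produces. All coherence laws are checked on these values. -/
lemma dual_cell_ext {F : R ⟶ S} {A : R.opp ⟶ S.opp} (d : AGJDual F) {a b : A ⟶ d.cell}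
    (h : ∀ (N : RMod R) (s : S) (x : (A.functor.obj N).obj.obj (op s)) (M : LMod R)
      (z : (F.functor.obj M).obj.obj s),
      component (d.equiv N s (cellApp a N (op s) x)) M z =
        component (d.equiv N s (cellApp b N (op s) x)) M z) : a = b := by
  apply two_cell_ext
  ext N s x
  exact (d.equiv N s.unop).injective (component_ext fun M z => h N s.unop x M z)

/-- With `component_delta` and `component_psi`, this gives the structure 2-cells on values, `equiv`
cancelling the inverse in their definitions. -/
lemma component_dualTwoCell {F G : R ⟶ S} (dF : AGJDual F) (dG : AGJDual G) (α : F ⟶ G)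
    (N : RMod R) (s : S) (x : (dG.cell.functor.obj N).obj.obj (op s)) (M : LMod R)
    (z : (F.functor.obj M).obj.obj s) :
    component (dF.equiv N s (cellApp (dualTwoCell dF dG α) N (op s) x)) M z =
      component (dG.equiv N s x) M (cellApp α M s z) :=
  congrArg (fun y => component y M z) (AddEquiv.apply_symm_apply (dF.equiv N s) _)

lemma component_delta {F : R ⟶ S} {G : S ⟶ T} (dF : AGJDual F) (dG : AGJDual G)
    (dGF : AGJDual (F ≫ G)) (N : RMod R) (t : T)
    (x : (dG.cell.functor.obj (dF.cell.functor.obj N)).obj.obj (op t)) (M : LMod R)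
    (z : (G.functor.obj (F.functor.obj M)).obj.obj t) :
    component (dGF.equiv N t (cellApp (delta dF dG dGF) N (op t) x)) M z =
      dualEval dF N M
        (component (dG.equiv (dF.cell.functor.obj N) t x) (F.functor.obj M) z) :=
  congrArg (fun y => component (F := (F ≫ G).functor) y M z)
    (AddEquiv.apply_symm_apply (dGF.equiv N t) _)

lemma component_psi (d : AGJDual (𝟙 R)) (N : RMod R) (r : R) (x : N.obj.obj (op r)) (M : LMod R)
    (z : M.obj.obj r) :
    component (d.equiv N r (cellApp (psi d) N (op r) x)) M z = tmul x z :=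
  congrArg (fun y => component (F := (𝟙 R : R ⟶ R).functor) y M z)
    (AddEquiv.apply_symm_apply (d.equiv N r) _)

/-- Evaluation is extranatural in the 1-cell. -/
lemma dualEval_dualTwoCell {F G : R ⟶ S} (dF : AGJDual F) (dG : AGJDual G) (α : F ⟶ G)
    (N : RMod R) (M : LMod R) (t : Tensor (dG.cell.functor.obj N).obj (F.functor.obj M).obj) :
    dualEval dF N M (tensorMap ((dualTwoCell dF dG α).nat.app N).hom (𝟙 _) t) =
      dualEval dG N M (tensorMap (𝟙 _) (α.nat.app M).hom t) := by
  refine DFunLike.congr_fun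
    (f := (dualEval dF N M).comp (tensorMap ((dualTwoCell dF dG α).nat.app N).hom (𝟙 _)))
    (g := (dualEval dG N M).comp (tensorMap (𝟙 _) (α.nat.app M).hom))
    (tensor_hom_ext fun s a z => ?_) t
  simp only [AddMonoidHom.comp_apply, tensorMap_tmul, dualEval_tmul, NatTrans.id_app]
  exact component_dualTwoCell dF dG α N s a M z

/-- Evaluation at a composite is iterated evaluation. -/
lemma dualEval_delta {F : R ⟶ S} {G : S ⟶ T} (dF : AGJDual F) (dG : AGJDual G)
    (dGF : AGJDual (F ≫ G)) (N : RMod R) (M : LMod R)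
    (t : Tensor (dG.cell.functor.obj (dF.cell.functor.obj N)).obj
      (G.functor.obj (F.functor.obj M)).obj) :
    dualEval dGF N M (tensorMap ((delta dF dG dGF).nat.app N).hom (𝟙 _) t) =
      dualEval dF N M (dualEval dG (dF.cell.functor.obj N) (F.functor.obj M) t) := by
  refine DFunLike.congr_fun
    (f := (dualEval dGF N M).comp (tensorMap ((delta dF dG dGF).nat.app N).hom (𝟙 _)))
    (g := (dualEval dF N M).comp (dualEval dG (dF.cell.functor.obj N) (F.functor.obj M)))
    (tensor_hom_ext fun s a z => ?_) t
  simp only [AddMonoidHom.comp_apply, tensorMap_tmul, dualEval_tmul, NatTrans.id_app]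
  exact (component_delta dF dG dGF N s a M z).trans
    (congrArg (dualEval dF N M) (dualEval_tmul dG _ _ a z).symm)

/-- Evaluation at the identity. -/
lemma dualEval_psi (d : AGJDual (𝟙 R)) (N : RMod R) (M : LMod R) (t : Tensor N.obj M.obj) :
    dualEval d N M (tensorMap ((psi d).nat.app N).hom (𝟙 _) t) = t := by
  refine DFunLike.congr_fun
    (f := (dualEval d N M).comp (tensorMap ((psi d).nat.app N).hom (𝟙 _)))
    (g := AddMonoidHom.id _) (tensor_hom_ext fun s a z => ?_) t
  refine (congrArg (dualEval d N M) (tensorMap_tmul _ _ _ _)).trans ?_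
  exact (dualEval_tmul d N M _ _).trans (component_psi d N s a M z)

end DualCells

/-! ### Axioms of the lax functor -/

section Coherence

variable {R S T U : MODCAT.{u}}

/-- Naturality of `x` along `α_M` turns `G(α_M)` into `1 ⊗ α_M`, and extranaturality of `β` moves
`α` to the other factor as `Dα`. -/
lemma delta_naturality_left {F F' : R ⟶ S} {G : S ⟶ T} (dF : AGJDual F) (dF' : AGJDual F')
    (dG : AGJDual G) (dGF : AGJDual (F ≫ G)) (dGF' : AGJDual (F' ≫ G)) (α : F' ⟶ F) :
    delta dF dG dGF ≫ dualTwoCell dGF' dGF (α ▷ G) =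
      dualTwoCell dF' dF α ▷ dG.cell ≫ delta dF' dG dGF' := by
  refine dual_cell_ext dGF' fun N t x M z => ?_
  refine (component_dualTwoCell dGF' dGF (α ▷ G) N t _ M z).trans ?_
  refine (component_delta dF dG dGF N t x M _).trans ?_
  refine Eq.trans ?_ (component_delta dF' dG dGF' N t _ M z).symm
  refine (congrArg (dualEval dF N M)
    (component_map (dG.equiv (dF.cell.functor.obj N) t x) (α.nat.app M) z)).trans ?_
  refine (dualEval_dualTwoCell dF' dF α N M _).symm.trans ?_
  exact congrArg (fun y => dualEval dF' N M (component y (F'.functor.obj M) z))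
    (dG.equiv_map_left ((dualTwoCell dF' dF α).nat.app N) t x).symm

lemma delta_naturality_right {F : R ⟶ S} {G G' : S ⟶ T} (dF : AGJDual F) (dG : AGJDual G)
    (dG' : AGJDual G') (dGF : AGJDual (F ≫ G)) (dGF' : AGJDual (F ≫ G')) (α : G' ⟶ G) :
    delta dF dG dGF ≫ dualTwoCell dGF' dGF (F ◁ α) =
      dF.cell ◁ dualTwoCell dG' dG α ≫ delta dF dG' dGF' := by
  refine dual_cell_ext dGF' fun N t x M z => ?_
  refine (component_dualTwoCell dGF' dGF (F ◁ α) N t _ M z).trans ?_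
  refine (component_delta dF dG dGF N t x M _).trans ?_
  refine Eq.trans ?_ (component_delta dF dG' dGF' N t _ M z).symm
  exact congrArg (dualEval dF N M)
    (component_dualTwoCell dG' dG α (dF.cell.functor.obj N) t x (F.functor.obj M) z).symm

/-- Both sides have value `β_F β_G x_{GFM}(z)`; on the left this is the identity `β_{GF} (δ ⊗ 1) =
β_F β_G`. -/
lemma delta_assoc {F : R ⟶ S} {G : S ⟶ T} {H : T ⟶ U} (dF : AGJDual F) (dG : AGJDual G)
    (dH : AGJDual H) (dGF : AGJDual (F ≫ G)) (dHG : AGJDual (G ≫ H))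
    (d : AGJDual ((F ≫ G) ≫ H)) (d' : AGJDual (F ≫ G ≫ H)) :
    delta dF dG dGF ▷ dH.cell ≫ delta dGF dH d ≫ dualTwoCell d' d (α_ F G H).inv =
      (α_ dF.cell dG.cell dH.cell).hom ≫ dF.cell ◁ delta dG dH dHG ≫ delta dF dHG d' := by
  refine dual_cell_ext d' fun N t x M z => ?_
  refine (component_dualTwoCell d' d (α_ F G H).inv N t _ M z).trans ?_
  refine (component_delta dGF dH d N t _ M z).trans ?_
  refine Eq.trans ?_ (component_delta dF dHG d' N t _ M z).symm
  refine (congrArg (fun y => dualEval dGF N M (component y _ z))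
    (dH.equiv_map_left ((delta dF dG dGF).nat.app N) t x)).trans ?_
  refine (dualEval_delta dF dG dGF N M _).trans (congrArg (dualEval dF N M) ?_)
  exact (component_delta dG dH dHG (dF.cell.functor.obj N) t x (F.functor.obj M) z).symm

lemma delta_psi_left {F : R ⟶ S} (dF : AGJDual F) (d : AGJDual (𝟙 R)) (d' : AGJDual (𝟙 R ≫ F)) :
    dualTwoCell d' dF (λ_ F).hom =
      (λ_ dF.cell).inv ≫ psi d ▷ dF.cell ≫ delta d dF d' := by
  refine dual_cell_ext d' fun N s x M z => ?_
  refine (component_dualTwoCell d' dF (λ_ F).hom N s x M z).trans ?_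
  refine Eq.trans ?_ (component_delta d dF d' N s _ M z).symm
  refine Eq.trans ?_ (congrArg (fun y => dualEval d N M (component y M z))
    (dF.equiv_map_left ((psi d).nat.app N) s x)).symm
  exact (dualEval_psi d N M _).symm

lemma delta_psi_right {F : R ⟶ S} (dF : AGJDual F) (d : AGJDual (𝟙 S)) (d' : AGJDual (F ≫ 𝟙 S)) :
    dualTwoCell d' dF (ρ_ F).hom =
      (ρ_ dF.cell).inv ≫ dF.cell ◁ psi d ≫ delta dF d d' := by
  refine dual_cell_ext d' fun N s x M z => ?_
  refine (component_dualTwoCell d' dF (ρ_ F).hom N s x M z).trans ?_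
  refine Eq.trans ?_ (component_delta dF d d' N s _ M z).symm
  refine Eq.trans ?_ (congrArg (dualEval dF N M)
    (component_psi d (dF.cell.functor.obj N) s x (F.functor.obj M) z)).symm
  exact (dualEval_tmul dF N M x z).symm

/-- The lax functor `(D, δ, ψ)`. -/
def dualLax (𝒟 : AGJChoice.{u}) : LaxFunctor (Co MODCAT.{u}) MODCAT.{u} where
  toPrelaxFunctor := dualPrelax 𝒟
  mapId R := psi (𝒟 (𝟙 R.unco))
  mapComp F G := delta (𝒟 F.unco) (𝒟 G.unco) (𝒟 (F.unco ≫ G.unco))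
  mapComp_naturality_left η _ := delta_naturality_left _ _ _ _ _ η.unco
  mapComp_naturality_right _ _ _ η := delta_naturality_right _ _ _ _ _ η.unco
  map₂_associator _ _ _ := delta_assoc _ _ _ _ _ _ _
  map₂_leftUnitor _ := delta_psi_left _ _ _
  map₂_rightUnitor _ := delta_psi_right _ _ _

end Coherence

/-! ### The monad dual to a comonad -/

section DualMonad

variable {R : MODCAT.{u}} (L : CategoryTheory.Comonad (LMod R)) (hadd : L.toFunctor.Additive)
  (hacc : Functor.IsAccessible.{u} L.toFunctor)

/-- The underlying 1-cell of a comonad. -/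
abbrev comonadCell : R ⟶ R := OneCell.mk L.toFunctor hadd hacc

/-- The comultiplication of a comonad, as a 2-cell. -/
abbrev comonadComul : comonadCell L hadd hacc ⟶ comonadCell L hadd hacc ≫ comonadCell L hadd hacc :=
  TwoCell.mk L.δ

/-- The counit of a comonad, as a 2-cell. -/
abbrev comonadCounit : comonadCell L hadd hacc ⟶ 𝟙 R := TwoCell.mk L.ε

variable {L hadd hacc} (dL : AGJDual (comonadCell L hadd hacc)) (d : AGJDual (𝟙 R))
  (dLL : AGJDual (comonadCell L hadd hacc ≫ comonadCell L hadd hacc))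

/-- The unit of the dual of a comonad. -/
abbrev dualUnit : 𝟙 R.opp ⟶ dL.cell :=
  psi d ≫ dualTwoCell dL d (comonadCounit L hadd hacc)

/-- The multiplication of the dual of a comonad. -/
abbrev dualMul : dL.cell ≫ dL.cell ⟶ dL.cell :=
  delta dL dL dLL ≫ dualTwoCell dL dLL (comonadComul L hadd hacc)

lemma component_dualUnit (N : RMod R) (r : R) (x : N.obj.obj (op r)) (M : LMod R)
    (z : (L.obj M).obj.obj r) :
    component (dL.equiv N r (cellApp (dualUnit dL d) N (op r) x)) M z =
      tmul x ((L.ε.app M).hom.app r z) :=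
  (component_dualTwoCell dL d (comonadCounit L hadd hacc) N r _ M z).trans
    (component_psi d N r x M _)

lemma component_dualMul (N : RMod R) (r : R)
    (x : (dL.cell.functor.obj (dL.cell.functor.obj N)).obj.obj (op r)) (M : LMod R)
    (z : (L.obj M).obj.obj r) :
    component (dL.equiv N r (cellApp (dualMul dL dLL) N (op r) x)) M z =
      dualEval dL N M (component (dL.equiv (dL.cell.functor.obj N) r x) (L.obj M)
        ((L.δ.app M).hom.app r z)) :=
  (component_dualTwoCell dL dLL (comonadComul L hadd hacc) N r _ M z).trans
    (component_delta dL dL dLL N r x M _)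

lemma dualEval_dualUnit (N : RMod R) (M : LMod R) (t : Tensor N.obj (L.obj M).obj) :
    dualEval dL N M (tensorMap ((dualUnit dL d).nat.app N).hom (𝟙 _) t) =
      tensorMap (𝟙 N.obj) (L.ε.app M).hom t := by
  refine DFunLike.congr_fun
    (f := (dualEval dL N M).comp (tensorMap ((dualUnit dL d).nat.app N).hom (𝟙 _)))
    (g := tensorMap (𝟙 N.obj) (L.ε.app M).hom) (tensor_hom_ext fun r a z => ?_) t
  refine (congrArg (dualEval dL N M) (tensorMap_tmul _ _ _ _)).trans ?_
  refine (dualEval_tmul dL N M _ _).trans ((component_dualUnit dL d N r a M z).trans ?_)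
  exact (tensorMap_tmul (𝟙 N.obj) (L.ε.app M).hom a z).symm

lemma dualEval_dualMul (N : RMod R) (M : LMod R)
    (t : Tensor (dL.cell.functor.obj (dL.cell.functor.obj N)).obj (L.obj M).obj) :
    dualEval dL N M (tensorMap ((dualMul dL dLL).nat.app N).hom (𝟙 _) t) =
      dualEval dL N M (dualEval dL (dL.cell.functor.obj N) (L.obj M)
        (tensorMap (𝟙 _) (L.δ.app M).hom t)) := by
  refine DFunLike.congr_fun
    (f := (dualEval dL N M).comp (tensorMap ((dualMul dL dLL).nat.app N).hom (𝟙 _)))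
    (g := (dualEval dL N M).comp ((dualEval dL (dL.cell.functor.obj N) (L.obj M)).comp
      (tensorMap (𝟙 _) (L.δ.app M).hom))) (tensor_hom_ext fun r a z => ?_) t
  refine (congrArg (dualEval dL N M) (tensorMap_tmul _ _ _ _)).trans ?_
  refine (dualEval_tmul dL N M _ _).trans ((component_dualMul dL dLL N r a M z).trans ?_)
  refine congrArg (dualEval dL N M) (Eq.symm ?_)
  refine (congrArg (dualEval dL (dL.cell.functor.obj N) (L.obj M))
    (tensorMap_tmul (𝟙 _) (L.δ.app M).hom a z)).trans ?_
  exact dualEval_tmul dL (dL.cell.functor.obj N) (L.obj M) a ((L.δ.app M).hom.app r z)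

/-- The analogue of `dual_cell_ext` at one fixed `N`, since the laws of a monad are stated object by
object. -/
lemma dual_hom_ext {X : RMod R} {N : RMod R} {f g : X ⟶ dL.cell.functor.obj N}
    (h : ∀ (r : R) (x : X.obj.obj (op r)) (M : LMod R) (z : (L.obj M).obj.obj r),
      component (dL.equiv N r (f.hom.app (op r) x)) M z =
        component (dL.equiv N r (g.hom.app (op r) x)) M z) : f = g := by
  apply ObjectProperty.hom_ext
  ext r x
  exact (dL.equiv N r.unop).injective (component_ext fun M z => h r.unop x M z)

/-- The dual of a comonad is a monad. -/
def dualMonad : CategoryTheory.Monad (RMod R) where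
  toFunctor := dL.cell.functor
  η := (dualUnit dL d).nat
  μ := (dualMul dL dLL).nat
  assoc N := by
    refine dual_hom_ext dL fun r x M z => ?_
    refine (component_dualMul dL dLL N r _ M z).trans ?_
    refine Eq.trans ?_ (component_dualMul dL dLL N r _ M z).symm
    refine (congrArg (fun y => dualEval dL N M (component y (L.obj M) ((L.δ.app M).hom.app r z)))
      (dL.equiv_map_left ((dualMul dL dLL).nat.app N) r x)).trans ?_
    refine (dualEval_dualMul dL dLL N M _).trans (congrArg (dualEval dL N M) ?_)
    refine Eq.trans ?_ (component_dualMul dL dLL (dL.cell.functor.obj N) r x (L.obj M) _).symm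
    refine congrArg (dualEval dL (dL.cell.functor.obj N) (L.obj M)) ?_
    -- Naturality of `x` along `Δ_M` turns `1 ⊗ Δ_M` into `L(Δ_M)` inside `x`, leaving
    -- coassociativity at `z`.
    refine (component_map (dL.equiv _ r x) (L.δ.app M) _).symm.trans ?_
    exact congrArg (component (dL.equiv _ r x) (L.obj (L.obj M)))
      (ConcreteCategory.congr_hom (congrArg (fun k => k.hom.app r) (L.coassoc M)) z)
  left_unit N := by
    refine dual_hom_ext dL fun r x M z => ?_
    refine (component_dualMul dL dLL N r _ M z).trans ?_
    refine (congrArg (dualEval dL N M)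
      (component_dualUnit dL d (dL.cell.functor.obj N) r x (L.obj M) _)).trans ?_
    refine (dualEval_tmul dL N M x _).trans (congrArg (component (dL.equiv N r x) M) ?_)
    exact ConcreteCategory.congr_hom (congrArg (fun k => k.hom.app r) (L.left_counit M)) z
  right_unit N := by
    refine dual_hom_ext dL fun r x M z => ?_
    refine (component_dualMul dL dLL N r _ M z).trans ?_
    refine (congrArg (fun y => dualEval dL N M (component y (L.obj M) ((L.δ.app M).hom.app r z)))
      (dL.equiv_map_left ((dualUnit dL d).nat.app N) r x)).trans ?_
    refine (dualEval_dualUnit dL d N M _).trans ?_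
    -- Likewise `1 ⊗ ε_M` becomes `L(ε_M)` inside `x`, and the counit law removes `L(ε_M) Δ_M`.
    refine (component_map (dL.equiv N r x) (L.ε.app M) _).symm.trans ?_
    exact congrArg (component (dL.equiv N r x) M)
      (ConcreteCategory.congr_hom (congrArg (fun k => k.hom.app r) (L.right_counit M)) z)

end DualMonad

end AGJ
end

theorem mainTheorem6 :
    (∀ (R S : AGJ.MODCAT.{u}) (F : R ⟶ S), Nonempty (AGJ.AGJDual F)) ∧
    ∀ 𝒟 : AGJ.AGJChoice.{u},
      (∃ D : LaxFunctor (AGJ.Co AGJ.MODCAT.{u}) AGJ.MODCAT.{u},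
        D.toPrelaxFunctor = AGJ.dualPrelax 𝒟 ∧
        D.mapId ≍ (fun R : AGJ.Co AGJ.MODCAT.{u} => AGJ.psi (𝒟 (𝟙 R.unco))) ∧
        @D.mapComp ≍ (fun (R S T : AGJ.Co AGJ.MODCAT.{u}) (F : R ⟶ S) (G : S ⟶ T) =>
          AGJ.delta (𝒟 F.unco) (𝒟 G.unco) (𝒟 (F.unco ≫ G.unco)))) ∧
      ∀ (R : AGJ.MODCAT.{u}) (L : CategoryTheory.Comonad (AGJ.LMod R)) (hadd : L.toFunctor.Additive)
        (hacc : Functor.IsAccessible.{u} L.toFunctor),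
        let L₁ : R ⟶ R := AGJ.OneCell.mk L.toFunctor hadd hacc
        let comul : L₁ ⟶ L₁ ≫ L₁ := AGJ.TwoCell.mk L.δ
        let counit : L₁ ⟶ 𝟙 R := AGJ.TwoCell.mk L.ε
        ∃ T : CategoryTheory.Monad (AGJ.RMod R),
          T.toFunctor = (𝒟 L₁).cell.functor ∧
          Functor.IsAccessible.{u} T.toFunctor ∧
          T.η ≍ (AGJ.psi (𝒟 (𝟙 R)) ≫ AGJ.dualTwoCell (𝒟 L₁) (𝒟 (𝟙 R)) counit).nat ∧
          T.μ ≍ (AGJ.delta (𝒟 L₁) (𝒟 L₁) (𝒟 (L₁ ≫ L₁)) ≫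
            AGJ.dualTwoCell (𝒟 L₁) (𝒟 (L₁ ≫ L₁)) comul).nat :=
  ⟨fun _ _ F => AGJ.nonempty_agjDual F, fun 𝒟 =>
    ⟨⟨AGJ.dualLax 𝒟, rfl, HEq.rfl, HEq.rfl⟩, fun R _ _ _ =>
      ⟨AGJ.dualMonad (𝒟 _) (𝒟 (𝟙 R)) (𝒟 _), rfl, (𝒟 _).cell.accessible, HEq.rfl, HEq.rfl⟩⟩⟩
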